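/- Let $(\Omega,\mathfrak F,\mathbf P)$ be a complete probability space, $d\in\mathbb N$ and $p\in[1,\infty]$. Let $\mathbf r=(r_1,\dots,r_d)$, where each $r_i:L^p(\mathbb R)\to\mathbb R$ is a (finite-valued) convex $L^p$-risk measure, that is, $r_i(\eta)\le r_i(\xi)$ whenever $\xi\le\eta$ a.s., $r_i(\xi+c)=r_i(\xi)-c$ for $c\in\mathbb R$, and $r_i$ is convex. If $p=\infty$, assume also that each $r_i$ has the Fatou property: $r_i(\xi)\le\liminf_n r_i(\xi_n)$ whenever $(\xi_n)$ is uniformly bounded and $\xi_n\to\xi$ a.s. Let $\mathbf X$ be a set-valued portfolio in $\mathbb R^d$, that is, a map from $\Omega$ to the closed subsets of $\mathbb R^d$ that are lower sets for the coordinatewise order, such that $\{\omega:\mathbf X(\omega)\cap K\neq\emptyset\}\in\mathfrak F$ for every compact $K\subset\mathbb R^d$, and such that there is a $p$-integrable selection of $\mathbf X$, i.e. a $p$-integrable random vector $\xi$ with $\xi\in\mathbf X$ a.s. Assume that $\mathbf X$ is a.s. convex. Let $\partial^+\mathbf X(\omega)$ be the set of Pareto optimal points of $\mathbf X(\omega)$,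 i.e. of those $x\in\mathbf X(\omega)$ for which no $y\in\mathbf X(\omega)$, $y\ne x$, satisfies $y\ge x$ coordinatewise. Assume that $\partial^+\mathbf X$ is $p$-integrably bounded: $\partial^+\mathbf X$ is a.s. non-empty and $\|\partial^+\mathbf X\|=\sup\{\|x\|:x\in\partial^+\mathbf X\}$ is a.s. finite and belongs to $L^p(\mathbb R)$. Then the set $$\mathsf R_0(\mathbf X)=\{a\in\mathbb R^d:\ \text{there is a } p\text{-integrable selection } \xi \text{ of } \mathbf X+a \text{ with } r_i(\xi_i)\le 0 \text{ for } i=1,\dots,d\}$$ is closed in $\mathbb R^d$. -/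

import Mathlib

open MeasureTheory Filter Topology
open scoped ENNReal

section Portfolios

variable {Ω : Type*} [MeasurableSpace Ω] {μ : Measure Ω} {p : ℝ≥0∞} {d : ℕ}

/-- `ξ` is a `p`-integrable selection of `X`. A `p`-integrable random vector in `ℝ^d` is given by
its `d` components, which are elements of `L^p(ℝ)`; `ξ` is a selection if it lies in `X` a.s. -/
def IsLpSelection (X : Ω → Set (Fin d → ℝ)) (ξ : Fin d → Lp ℝ p μ) : Prop :=
  ∀ᵐ ω ∂μ, (fun i => ξ i ω) ∈ X ω

/-- A set-valued portfolio: a random closed set in `ℝ^d` whose values are lower sets for the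
coordinatewise order, and which has at least one `p`-integrable selection. -/
structure IsSetValuedPortfolio (μ : Measure Ω) (p : ℝ≥0∞) (X : Ω → Set (Fin d → ℝ)) : Prop where
  isClosed : ∀ ω, IsClosed (X ω)
  isLowerSet : ∀ ω, IsLowerSet (X ω)
  measurableSet_hit : ∀ K : Set (Fin d → ℝ), IsCompact K → MeasurableSet {ω | (X ω ∩ K).Nonempty}
  exists_selection : ∃ ξ : Fin d → Lp ℝ p μ, IsLpSelection X ξ

/-- The set of Pareto optimal points of `A`: the points of `A` that are not dominated
coordinatewise by any other point of `A`. -/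
def paretoBoundary (A : Set (Fin d → ℝ)) : Set (Fin d → ℝ) :=
  {x | Maximal (fun y => y ∈ A) x}

/-- `sup {‖x‖ : x ∈ A}` for the Euclidean norm, as an extended real number; it equals `-∞` for the
empty set and `+∞` for an unbounded set. -/
noncomputable def setNorm (A : Set (Fin d → ℝ)) : EReal :=
  ⨆ x ∈ A, ((‖(WithLp.toLp 2 x : EuclideanSpace ℝ (Fin d))‖ : ℝ) : EReal)

/-- The random set `Z` is `p`-integrably bounded: `sup {‖x‖ : x ∈ Z}` is almost surely a (finite)
real number and belongs to `L^p(ℝ)`. -/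
def IsIntegrablyBounded (μ : Measure Ω) (p : ℝ≥0∞) (Z : Ω → Set (Fin d → ℝ)) : Prop :=
  ∃ η : Ω → ℝ, MemLp η p μ ∧ ∀ᵐ ω ∂μ, setNorm (Z ω) = (η ω : EReal)

/-- A finite convex `L^p`-risk measure: decreasing, cash invariant and convex. -/
structure IsConvexRiskMeasure [IsFiniteMeasure μ] (r : Lp ℝ p μ → ℝ) : Prop where
  antitone : ∀ ξ η : Lp ℝ p μ, ξ ≤ η → r η ≤ r ξ
  cash_invariant : ∀ (ξ : Lp ℝ p μ) (c : ℝ), r (ξ + Lp.const p μ c) = r ξ - c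
  convex : ∀ (ξ η : Lp ℝ p μ) (t : ℝ), 0 ≤ t → t ≤ 1 →
    r (t • ξ + (1 - t) • η) ≤ t * r ξ + (1 - t) * r η

/-- The Fatou property: lower semicontinuity with respect to bounded a.s. convergence. -/
def HasFatouProperty (r : Lp ℝ p μ → ℝ) : Prop :=
  ∀ (ξ : ℕ → Lp ℝ p μ) (ζ : Lp ℝ p μ) (C : ℝ),
    (∀ n, ∀ᵐ ω ∂μ, |ξ n ω| ≤ C) →
    (∀ᵐ ω ∂μ, Tendsto (fun n => ξ n ω) atTop (𝓝 (ζ ω))) →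
    (r ζ : EReal) ≤ liminf (fun n => (r (ξ n) : EReal)) atTop

/-- `X` is acceptable: some `p`-integrable selection has individually acceptable components. -/
def IsAcceptable (r : Fin d → Lp ℝ p μ → ℝ) (X : Ω → Set (Fin d → ℝ)) : Prop :=
  ∃ ξ : Fin d → Lp ℝ p μ, IsLpSelection X ξ ∧ ∀ i, r i (ξ i) ≤ 0

/-- The set `R₀(X)` of all deterministic `a` such that `X + a` is acceptable. -/
def selectionRisk₀ (r : Fin d → Lp ℝ p μ → ℝ) (X : Ω → Set (Fin d → ℝ)) : Set (Fin d → ℝ) :=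
  {a | IsAcceptable r (fun ω => (fun x => x + a) '' X ω)}

end Portfolios

/-!
The argument replaces measurable selections and weak compactness by two elementary devices.

*Domination.* If a closed convex set `A` has a Pareto optimal point, then every `y ∈ A` lies below
one (`exists_le_mem_paretoBoundary`): the part of `A` above `y` is bounded, since a nonnegative
recession direction of `A` could be added to the given Pareto optimal point. If moreover the Pareto
optimal points have norm at most `c` and `A` is a lower set, the vector `max (y i) (-c)` is below
the same Pareto optimal point and hence belongs to `A`. Applied pointwise, this explicit formula
turns every `p`-integrable selection of `X` into a larger one whose components are dominated by
`η = ‖∂⁺X‖ ∈ L^p` (`exists_dominated_selection`). The risks do not increase.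

*Compactness.* By cash invariance, `a ∈ R₀(X)` means that some selection `ξ` of `X` satisfies
`r i (ξ i) ≤ a i` for all `i`. For `a` in the closure of `R₀(X)` and every `n`, there is a dominated
selection with risks at most `a i + 1 / (n + 1)`. Divided by `1 + |η|`, the dominated selections
with risks at most `c` form a bounded convex subset of the Hilbert space `L²(Ω; ℝ^d)`. It is closed,
because the sublevel sets of a convex risk measure are closed under dominated almost sure
convergence (`IsConvexRiskMeasure.le_of_dominated`): this is the Fatou property for `p = ∞`, and for
finite `p` it follows from dominated convergence in `L^p` and the norm closedness of sublevel sets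
of a finite monotone convex functional (`IsConvexRiskMeasure.le_of_tendsto`). A decreasing sequence
of nonempty bounded closed convex sets in a Hilbert space has a common point
(`Convex.nonempty_iInter_of_antitone_of_isBounded`), and this point yields a selection with risks
at most `a`.
-/

/-! ### Pareto optimal points of closed convex sets -/

section Deterministic

variable {d : ℕ} {A : Set (Fin d → ℝ)}

/-- Otherwise `A` would contain `z n ≥ y` with `‖z n - x‖ → ∞`; a limit `u` of the directions
`(z n - x) / ‖z n - x‖` is nonnegative and nonzero, and `x + u ∈ A` dominates `x`. -/
theorem isBounded_inter_Ici_of_maximal (hA : IsClosed A) (hconv : Convex ℝ A) {x : Fin d → ℝ}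
    (hx : x ∈ paretoBoundary A) (y : Fin d → ℝ) : Bornology.IsBounded (A ∩ Set.Ici y) := by
  by_contra hunb
  have hex : ∀ n : ℕ, ∃ z ∈ A ∩ Set.Ici y, (n : ℝ) + 1 < ‖z - x‖ := by
    intro n
    by_contra! hcon
    refine hunb ((Metric.isBounded_iff_subset_closedBall x).2 ⟨n + 1, fun z hz => ?_⟩)
    rw [Metric.mem_closedBall, dist_eq_norm]
    exact hcon z hz
  choose z hz hzn using hex
  set t : ℕ → ℝ := fun n => ‖z n - x‖ with ht
  have ht1 : ∀ n, 1 ≤ t n := fun n => by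
    have := hzn n
    have h0 : (0 : ℝ) ≤ n := n.cast_nonneg
    simp only [ht]
    linarith
  have htt : Tendsto t atTop atTop :=
    tendsto_atTop_mono (fun n => by have := hzn n; simp only [ht]; linarith)
      tendsto_natCast_atTop_atTop
  set u : ℕ → Fin d → ℝ := fun n => (t n)⁻¹ • (z n - x) with hu
  have hus : ∀ n, u n ∈ Metric.sphere (0 : Fin d → ℝ) 1 := fun n => by
    have h0 : 0 < t n := zero_lt_one.trans_le (ht1 n)
    rw [mem_sphere_zero_iff_norm, hu]
    simp only [norm_smul, norm_inv, Real.norm_of_nonneg h0.le]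
    exact inv_mul_cancel₀ h0.ne'
  obtain ⟨v, hv, φ, hφ, hlim⟩ := (isCompact_sphere (0 : Fin d → ℝ) 1).tendsto_subseq hus
  have hxv : x + v ∈ A := by
    refine hA.mem_of_tendsto (tendsto_const_nhds.add hlim) (Eventually.of_forall fun n => ?_)
    have h := hconv.add_smul_sub_mem hx.1 (hz (φ n)).1 (t := (t (φ n))⁻¹)
      ⟨inv_nonneg.2 (zero_le_one.trans (ht1 _)), inv_le_one_of_one_le₀ (ht1 _)⟩
    exact h
  have hv0 : 0 ≤ v := by
    have hlow : Tendsto (fun n => (t (φ n))⁻¹ • (y - x)) atTop (𝓝 ((0 : ℝ) • (y - x))) :=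
      ((tendsto_inv_atTop_zero.comp htt).comp hφ.tendsto_atTop).smul_const _
    rw [zero_smul] at hlow
    refine le_of_tendsto_of_tendsto' hlow hlim fun n => ?_
    exact smul_le_smul_of_nonneg_left (sub_le_sub_right (hz (φ n)).2 x)
      (inv_nonneg.2 (zero_le_one.trans (ht1 _)))
  have hle : x + v ≤ x := hx.2 hxv (le_add_of_nonneg_right hv0)
  have hv0' : v = 0 := le_antisymm (by simpa using hle) hv0
  simp [hv0'] at hv

theorem exists_le_mem_paretoBoundary (hA : IsClosed A) (hconv : Convex ℝ A)
    (hne : (paretoBoundary A).Nonempty) {y : Fin d → ℝ} (hy : y ∈ A) :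
    ∃ z ∈ paretoBoundary A, y ≤ z := by
  obtain ⟨x, hx⟩ := hne
  have hcomp : IsCompact (A ∩ Set.Ici y) :=
    Metric.isCompact_of_isClosed_isBounded (hA.inter isClosed_Ici)
      (isBounded_inter_Ici_of_maximal hA hconv hx y)
  -- a maximizer of the coordinate sum over the points of `A` above `y` is Pareto optimal
  obtain ⟨z, hz, hmax⟩ := hcomp.exists_isMaxOn ⟨y, hy, le_refl y⟩
    (f := fun z : Fin d → ℝ => ∑ i, z i) (by fun_prop)
  refine ⟨z, ⟨hz.1, fun w hw hzw => ?_⟩, hz.2⟩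
  have hsum : ∑ i, w i ≤ ∑ i, z i := hmax ⟨hw, le_trans hz.2 hzw⟩
  have heq := (Finset.sum_eq_sum_iff_of_le (fun i _ => hzw i)).1
    (le_antisymm (Finset.sum_le_sum fun i _ => hzw i) hsum)
  exact fun i => (heq i (Finset.mem_univ i)).ge

/-- Raising every coordinate of `y ∈ A` to at least `-c` stays below the Pareto optimal point that
dominates `y`. -/
theorem max_neg_mem_of_setNorm_paretoBoundary (hA : IsClosed A) (hlow : IsLowerSet A)
    (hconv : Convex ℝ A) {c : ℝ} (hc : setNorm (paretoBoundary A) = (c : EReal))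
    {y : Fin d → ℝ} (hy : y ∈ A) :
    (fun i => max (y i) (-c)) ∈ A ∧ ∀ i, |max (y i) (-c)| ≤ c := by
  have hne : (paretoBoundary A).Nonempty := by
    by_contra h
    rw [Set.not_nonempty_iff_eq_empty] at h
    simp [setNorm, h] at hc
  obtain ⟨z, hz, hyz⟩ := exists_le_mem_paretoBoundary hA hconv hne hy
  have hzc : ‖(WithLp.toLp 2 z : EuclideanSpace ℝ (Fin d))‖ ≤ c := by
    rw [← EReal.coe_le_coe_iff, ← hc]
    exact le_iSup₂ (f := fun (x : Fin d → ℝ) (_ : x ∈ paretoBoundary A) =>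
      ((‖(WithLp.toLp 2 x : EuclideanSpace ℝ (Fin d))‖ : ℝ) : EReal)) z hz
  have hzi : ∀ i, |z i| ≤ c := fun i =>
    (PiLp.norm_apply_le (WithLp.toLp 2 z : EuclideanSpace ℝ (Fin d)) i).trans hzc
  have hle : ∀ i, max (y i) (-c) ≤ z i := fun i => max_le (hyz i) (abs_le.1 (hzi i)).1
  exact ⟨hlow (fun i => hle i) hz.1, fun i =>
    abs_le.2 ⟨le_max_right _ _, (hle i).trans (abs_le.1 (hzi i)).2⟩⟩

end Deterministic

/-! ### Decreasing sequences of bounded closed convex sets in a Hilbert space -/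

/-- The points of minimal norm of the sets form a Cauchy sequence, by the parallelogram identity,
and its limit lies in every set. -/
theorem Convex.nonempty_iInter_of_antitone_of_isBounded {H : Type*} [NormedAddCommGroup H]
    [InnerProductSpace ℝ H] [CompleteSpace H] {V : ℕ → Set H} (hanti : Antitone V)
    (hconv : ∀ n, Convex ℝ (V n)) (hclosed : ∀ n, IsClosed (V n)) (hne : ∀ n, (V n).Nonempty)
    (hbdd : Bornology.IsBounded (V 0)) : (⋂ n, V n).Nonempty := by
  have hmin : ∀ n, ∃ v ∈ V n, ∀ w ∈ V n, ‖v‖ ≤ ‖w‖ := by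
    intro n
    obtain ⟨v, hv, h⟩ :=
      exists_norm_eq_iInf_of_complete_convex (hne n) (hclosed n).isComplete (hconv n) 0
    refine ⟨v, hv, fun w hw => ?_⟩
    have : ‖(0 : H) - v‖ ≤ ‖0 - w‖ := by
      rw [h]
      exact ciInf_le (f := fun w : V n => ‖(0 : H) - w‖)
        ⟨0, Set.forall_mem_range.2 fun _ => norm_nonneg _⟩ ⟨w, hw⟩
    simpa using this
  choose v hv hvmin using hmin
  obtain ⟨C, hC⟩ := hbdd.exists_norm_le
  have hmono : Monotone fun n => ‖v n‖ ^ 2 := fun m n hmn =>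
    pow_le_pow_left₀ (norm_nonneg _) (hvmin m _ (hanti hmn (hv n))) 2
  have hub : BddAbove (Set.range fun n => ‖v n‖ ^ 2) :=
    ⟨C ^ 2, Set.forall_mem_range.2 fun n =>
      pow_le_pow_left₀ (norm_nonneg _) (hC _ (hanti n.zero_le (hv n))) 2⟩
  set L := ⨆ n, ‖v n‖ ^ 2
  have hlim : Tendsto (fun n => ‖v n‖ ^ 2) atTop (𝓝 L) := tendsto_atTop_ciSup hmono hub
  have hpar : ∀ N n, N ≤ n → ‖v n - v N‖ ^ 2 ≤ 2 * (L - ‖v N‖ ^ 2) := by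
    intro N n hn
    have hmid : (1 / 2 : ℝ) • v n + (1 / 2 : ℝ) • v N ∈ V N :=
      hconv N (hanti hn (hv n)) (hv N) (by norm_num) (by norm_num) (by norm_num)
    have h1 := hvmin N _ hmid
    rw [← smul_add, norm_smul, Real.norm_of_nonneg (by norm_num)] at h1
    have h2 := parallelogram_law_with_norm ℝ (v n) (v N)
    have h3 : ‖v n‖ ^ 2 ≤ L := le_ciSup hub n
    nlinarith [norm_nonneg (v N), norm_nonneg (v n + v N)]
  have hcauchy : CauchySeq v := by
    refine Metric.cauchySeq_iff'.2 fun ε hε => ?_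
    have hev : ∀ᶠ N in atTop, L - ε ^ 2 / 2 < ‖v N‖ ^ 2 :=
      hlim.eventually_const_lt (by have := pow_pos hε 2; linarith)
    obtain ⟨N, hN⟩ := hev.exists
    refine ⟨N, fun n hn => ?_⟩
    rw [dist_eq_norm]
    exact lt_of_pow_lt_pow_left₀ 2 hε.le (by linarith [hpar N n hn])
  obtain ⟨w, hw⟩ := cauchySeq_tendsto_of_complete hcauchy
  refine ⟨w, Set.mem_iInter.2 fun n => (hclosed n).mem_of_tendsto hw ?_⟩
  filter_upwards [eventually_ge_atTop n] with m hm using hanti hm (hv m)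

/-! ### Sublevel sets of convex risk measures -/

section RiskMeasure

variable {Ω : Type*} [MeasurableSpace Ω] {μ : Measure Ω} {p : ℝ≥0∞}

/-- Dominated convergence in `L^p` for finite `p`. -/
theorem tendsto_Lp_of_dominated [Fact (1 ≤ p)] (hp : p ≠ ∞) {ξ : ℕ → Lp ℝ p μ} {ζ : Lp ℝ p μ}
    {η : Ω → ℝ} (hη : MemLp η p μ) (hξ : ∀ n, ∀ᵐ ω ∂μ, |ξ n ω| ≤ η ω)
    (hlim : ∀ᵐ ω ∂μ, Tendsto (fun n => ξ n ω) atTop (𝓝 (ζ ω))) :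
    Tendsto ξ atTop (𝓝 ζ) := by
  have hp0 : p ≠ 0 := (zero_lt_one.trans_le (Fact.out : 1 ≤ p)).ne'
  have hpos : 0 < p.toReal := ENNReal.toReal_pos hp0 hp
  rw [Lp.tendsto_Lp_iff_tendsto_eLpNorm']
  have hζ : ∀ᵐ ω ∂μ, |ζ ω| ≤ η ω := by
    filter_upwards [ae_all_iff.2 hξ, hlim] with ω h1 h2
    exact le_of_tendsto' h2.abs h1
  have h2η : MemLp (fun ω => 2 * η ω) p μ := hη.const_mul 2
  have hint : Tendsto (fun n => ∫⁻ ω, ‖(ξ n - ζ : Ω → ℝ) ω‖ₑ ^ p.toReal ∂μ) atTop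
      (𝓝 (∫⁻ _, 0 ∂μ)) := by
    refine tendsto_lintegral_of_dominated_convergence' (fun ω => ‖2 * η ω‖ₑ ^ p.toReal)
      (fun n => ?_) (fun n => ?_) ?_ ?_
    · exact (((Lp.aestronglyMeasurable (ξ n)).sub (Lp.aestronglyMeasurable ζ)).enorm).pow_const _
    · filter_upwards [hξ n, hζ] with ω h1 h2
      refine ENNReal.rpow_le_rpow (enorm_le_iff_norm_le.2 ?_) hpos.le
      rw [Pi.sub_apply, Real.norm_eq_abs, Real.norm_eq_abs]
      calc |ξ n ω - ζ ω| ≤ |ξ n ω| + |ζ ω| := abs_sub _ _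
        _ ≤ 2 * η ω := by linarith
        _ ≤ _ := le_abs_self _
    · exact (lintegral_rpow_enorm_lt_top_of_eLpNorm_lt_top hp0 hp h2η.2).ne
    · filter_upwards [hlim] with ω h
      have h0 : Tendsto (fun n => (ξ n - ζ : Ω → ℝ) ω) atTop (𝓝 0) := by
        simpa using h.sub_const (ζ ω)
      have := (ENNReal.continuous_rpow_const (y := p.toReal)).tendsto _ |>.comp h0.enorm
      simpa [hpos, Function.comp_def] using this
  rw [lintegral_zero] at hint
  have := (ENNReal.continuous_rpow_const (y := 1 / p.toReal)).tendsto _ |>.comp hint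
  rw [ENNReal.zero_rpow_of_pos (by positivity)] at this
  refine this.congr fun n => ?_
  rw [eLpNorm_eq_lintegral_rpow_enorm_toReal hp0 hp]
  rfl

theorem Lp.posSMulMono : PosSMulMono ℝ (Lp ℝ p μ) := by
  refine ⟨fun c hc f g hfg => ?_⟩
  rw [← Lp.coeFn_le] at hfg ⊢
  filter_upwards [hfg, Lp.coeFn_smul c f, Lp.coeFn_smul c g] with ω h1 h2 h3
  rw [h2, h3]
  exact mul_le_mul_of_nonneg_left h1 hc

variable [IsFiniteMeasure μ] {r : Lp ℝ p μ → ℝ}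

/-- A finite monotone convex functional on `L^p` has norm closed sublevel sets. Along a fast
subsequence, `ξ n ≤ ζ + h / (n + 1)` with a single `h ∈ L^p`, so that `r (ζ + h / (n + 1)) ≤ c`;
and `ζ` is the convex combination of `ζ + h / (n + 1)` and `ζ - h` in which `ζ - h` has
weight `1 / (n + 2)`. -/
theorem IsConvexRiskMeasure.le_of_tendsto [Fact (1 ≤ p)] (hr : IsConvexRiskMeasure r)
    {ξ : ℕ → Lp ℝ p μ} {ζ : Lp ℝ p μ} (hlim : Tendsto ξ atTop (𝓝 ζ)) {c : ℝ}
    (hc : ∀ n, r (ξ n) ≤ c) : r ζ ≤ c := by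
  have := Lp.posSMulMono (μ := μ) (p := p)
  have hex : ∀ n : ℕ, ∃ k, ‖ξ k - ζ‖ < (1 / 2) ^ n / ((n : ℝ) + 1) := fun n =>
    ((tendsto_iff_norm_sub_tendsto_zero.1 hlim).eventually_lt_const (by positivity)).exists
  choose k hk using hex
  set f : ℕ → Lp ℝ p μ := fun n => ((n : ℝ) + 1) • |ξ (k n) - ζ| with hf
  have hf0 : ∀ n, 0 ≤ f n := fun n => smul_nonneg (by positivity) (abs_nonneg _)
  have hsum : Summable f := by
    refine Summable.of_norm_bounded summable_geometric_two fun n => ?_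
    rw [hf, norm_smul, norm_abs_eq_norm, Real.norm_of_nonneg (by positivity), mul_comm]
    exact ((lt_div_iff₀ (by positivity)).1 (hk n)).le
  set h := ∑' n, f n
  have hfh : ∀ n, f n ≤ h := fun n => hsum.le_tsum n fun m _ => hf0 m
  have hbound : ∀ n : ℕ, r (ζ + ((n : ℝ) + 1)⁻¹ • h) ≤ c := by
    intro n
    refine (hr.antitone _ _ ?_).trans (hc (k n))
    have h1 : ξ (k n) - ζ ≤ ((n : ℝ) + 1)⁻¹ • h := by
      calc ξ (k n) - ζ ≤ |ξ (k n) - ζ| := le_abs_self _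
        _ = ((n : ℝ) + 1)⁻¹ • f n := by
          rw [hf, smul_smul, inv_mul_cancel₀ (by positivity), one_smul]
        _ ≤ _ := smul_le_smul_of_nonneg_left (hfh n) (by positivity)
    exact sub_le_iff_le_add'.1 h1
  have hcomb : ∀ n : ℕ, r ζ ≤ c + (1 / ((n : ℝ) + 1)) * |r (ζ - h) - c| := by
    intro n
    set t : ℝ := ((n : ℝ) + 1) / (n + 2) with ht
    have ht0 : 0 ≤ t := by positivity
    have ht1 : t ≤ 1 := (div_le_one (by positivity)).2 (by linarith)
    have ht2 : 1 - t ≤ 1 / ((n : ℝ) + 1) := by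
      have : 1 - t = 1 / ((n : ℝ) + 2) := by rw [ht]; field_simp; ring
      rw [this]
      exact one_div_le_one_div_of_le (by positivity) (by linarith)
    have hconv := hr.convex (ζ + ((n : ℝ) + 1)⁻¹ • h) (ζ - h) t ht0 ht1
    have heq : t • (ζ + ((n : ℝ) + 1)⁻¹ • h) + (1 - t) • (ζ - h) = ζ := by
      have : t * ((n : ℝ) + 1)⁻¹ = 1 - t := by rw [ht]; field_simp; ring
      rw [smul_add, smul_smul, this]
      module
    rw [heq] at hconv
    have h1 := mul_le_mul_of_nonneg_left (hbound n) ht0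
    have h2 := mul_le_mul_of_nonneg_left (le_abs_self (r (ζ - h) - c)) (sub_nonneg.2 ht1)
    have h3 := mul_le_mul_of_nonneg_right ht2 (abs_nonneg (r (ζ - h) - c))
    linarith
  have htend : Tendsto (fun n : ℕ => c + (1 / ((n : ℝ) + 1)) * |r (ζ - h) - c|) atTop
      (𝓝 (c + 0 * |r (ζ - h) - c|)) :=
    (tendsto_one_div_add_atTop_nhds_zero_nat.mul_const _).const_add _
  simpa using ge_of_tendsto' htend hcomb

theorem IsConvexRiskMeasure.le_of_dominated [Fact (1 ≤ p)] (hr : IsConvexRiskMeasure r)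
    (hFatou : p = ∞ → HasFatouProperty r) {ξ : ℕ → Lp ℝ p μ} {ζ : Lp ℝ p μ} {η : Ω → ℝ}
    (hη : MemLp η p μ) (hξ : ∀ n, ∀ᵐ ω ∂μ, |ξ n ω| ≤ η ω)
    (hlim : ∀ᵐ ω ∂μ, Tendsto (fun n => ξ n ω) atTop (𝓝 (ζ ω))) {c : ℝ}
    (hc : ∀ n, r (ξ n) ≤ c) : r ζ ≤ c := by
  by_cases hp : p = ∞
  · subst hp
    have hfin : eLpNormEssSup η μ ≠ ∞ := by simpa using hη.2.ne
    have hηC : ∀ᵐ ω ∂μ, η ω ≤ (eLpNormEssSup η μ).toReal := by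
      filter_upwards [ae_le_eLpNormEssSup (f := η) (μ := μ)] with ω hω
      have := ENNReal.toReal_mono hfin hω
      rw [toReal_enorm] at this
      exact (le_abs_self _).trans this
    have h := hFatou rfl ξ ζ _ (fun n => by
      filter_upwards [hξ n, hηC] with ω h1 h2 using h1.trans h2) hlim
    have hle : liminf (fun n => (r (ξ n) : EReal)) atTop ≤ (c : EReal) :=
      liminf_le_of_le (by isBoundedDefault) fun b hb => by
        obtain ⟨n, hn⟩ := hb.exists
        exact hn.trans (EReal.coe_le_coe_iff.2 (hc n))
    exact EReal.coe_le_coe_iff.1 (h.trans hle)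
  · exact hr.le_of_tendsto (tendsto_Lp_of_dominated hp hη hξ hlim) hc

end RiskMeasure

/-! ### Acceptable selections inside a Hilbert space -/

section Selections

variable {Ω : Type*} [MeasurableSpace Ω] {μ : Measure Ω} {p : ℝ≥0∞} {d : ℕ}

theorem mem_selectionRisk₀_iff [IsFiniteMeasure μ] {r : Fin d → Lp ℝ p μ → ℝ}
    (hr : ∀ i, IsConvexRiskMeasure (r i)) {X : Ω → Set (Fin d → ℝ)} {a : Fin d → ℝ} :
    a ∈ selectionRisk₀ r X ↔
      ∃ ξ : Fin d → Lp ℝ p μ, IsLpSelection X ξ ∧ ∀ i, r i (ξ i) ≤ a i := by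
  have hshift : ∀ (ξ : Fin d → Lp ℝ p μ) (b : Fin d → ℝ), ∀ᵐ ω ∂μ,
      (fun i => (ξ i + Lp.const p μ (b i) : Lp ℝ p μ) ω) = (fun i => ξ i ω) + b := by
    intro ξ b
    filter_upwards [ae_all_iff.2 fun i => Lp.coeFn_add (ξ i) (Lp.const p μ (b i)),
      ae_all_iff.2 fun i => Lp.coeFn_const p μ (b i)] with ω h1 h2
    funext i
    rw [h1 i, Pi.add_apply, h2 i]
    rfl
  constructor
  · rintro ⟨ξ, hξ, hξr⟩
    refine ⟨fun i => ξ i + Lp.const p μ ((-a) i), ?_, fun i => ?_⟩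
    · filter_upwards [hξ, hshift ξ (-a)] with ω h1 h2
      obtain ⟨x, hx, hxe⟩ := h1
      rw [h2, ← hxe]
      simpa using hx
    · rw [(hr i).cash_invariant, Pi.neg_apply]
      linarith [hξr i]
  · rintro ⟨ξ, hξ, hξr⟩
    refine ⟨fun i => ξ i + Lp.const p μ (a i), ?_, fun i => ?_⟩
    · filter_upwards [hξ, hshift ξ a] with ω h1 h2
      exact ⟨_, h1, h2.symm⟩
    · rw [(hr i).cash_invariant]
      linarith [hξr i]

/-- Any selection can be replaced by a larger one whose components are dominated by the bound on
the Pareto optimal points; the risks can only decrease. -/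
theorem exists_dominated_selection [IsFiniteMeasure μ] {r : Fin d → Lp ℝ p μ → ℝ}
    (hr : ∀ i, IsConvexRiskMeasure (r i)) {X : Ω → Set (Fin d → ℝ)}
    (hclosed : ∀ ω, IsClosed (X ω)) (hlow : ∀ ω, IsLowerSet (X ω))
    (hconv : ∀ᵐ ω ∂μ, Convex ℝ (X ω)) {η : Ω → ℝ} (hη : MemLp η p μ)
    (hXη : ∀ᵐ ω ∂μ, setNorm (paretoBoundary (X ω)) = (η ω : EReal))
    {ξ : Fin d → Lp ℝ p μ} (hξ : IsLpSelection X ξ) :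
    ∃ ζ : Fin d → Lp ℝ p μ, IsLpSelection X ζ ∧ (∀ i, ∀ᵐ ω ∂μ, |ζ i ω| ≤ η ω) ∧
      ∀ i, r i (ζ i) ≤ r i (ξ i) := by
  set ν : Lp ℝ p μ := hη.neg.toLp
  have hν : ∀ᵐ ω ∂μ, ν ω = -η ω := hη.neg.coeFn_toLp
  have hmax : ∀ᵐ ω ∂μ, ∀ i, (ξ i ⊔ ν : Lp ℝ p μ) ω = max (ξ i ω) (-η ω) := by
    filter_upwards [ae_all_iff.2 fun i => Lp.coeFn_sup (ξ i) ν, hν] with ω h1 h2 i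
    rw [h1 i, Pi.sup_apply, h2]
  have key : ∀ᵐ ω ∂μ, (fun i => max (ξ i ω) (-η ω)) ∈ X ω ∧
      ∀ i, |max (ξ i ω) (-η ω)| ≤ η ω := by
    filter_upwards [hξ, hconv, hXη] with ω h1 h2 h3
    exact max_neg_mem_of_setNorm_paretoBoundary (hclosed ω) (hlow ω) h2 h3 h1
  refine ⟨fun i => ξ i ⊔ ν, ?_, fun i => ?_, fun i => (hr i).antitone _ _ le_sup_left⟩
  · filter_upwards [hmax, key] with ω h1 h2
    simpa only [h1] using h2.1
  · filter_upwards [hmax, key] with ω h1 h2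
    rw [h1 i]
    exact h2.2 i

/-- The selections of `X` whose components are dominated by `η` and have risks at most `c`, each
divided by `1 + |η|`. The division places them in the Hilbert space `L²(Ω; ℝ^d)`, whatever the
exponent `p` is. -/
def scaledSelections (r : Fin d → Lp ℝ p μ → ℝ) (X : Ω → Set (Fin d → ℝ)) (η : Ω → ℝ)
    (c : Fin d → ℝ) : Set (Lp (EuclideanSpace ℝ (Fin d)) 2 μ) :=
  {h | ∃ ξ : Fin d → Lp ℝ p μ, (∀ᵐ ω ∂μ, ∀ i, ξ i ω = (1 + |η ω|) * h ω i) ∧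
    IsLpSelection X ξ ∧ (∀ i, ∀ᵐ ω ∂μ, |ξ i ω| ≤ η ω) ∧ ∀ i, r i (ξ i) ≤ c i}

variable {r : Fin d → Lp ℝ p μ → ℝ} {X : Ω → Set (Fin d → ℝ)} {η : Ω → ℝ}

theorem scaledSelections_mono {c c' : Fin d → ℝ} (hc : c ≤ c') :
    scaledSelections r X η c ⊆ scaledSelections r X η c' := by
  rintro h ⟨ξ, h1, h2, h3, h4⟩
  exact ⟨ξ, h1, h2, h3, fun i => (h4 i).trans (hc i)⟩

theorem norm_le_sqrt_of_eq_one_add_abs_mul {x : EuclideanSpace ℝ (Fin d)} {y : Fin d → ℝ} {e : ℝ}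
    (hx : ∀ i, y i = (1 + |e|) * x i) (hy : ∀ i, |y i| ≤ e) : ‖x‖ ≤ √d := by
  have hx1 : ∀ i, ‖x i‖ ≤ 1 := fun i => by
    have h0 : 0 < 1 + |e| := by positivity
    have h1 := hy i
    rw [hx i, abs_mul, abs_of_pos h0] at h1
    rw [Real.norm_eq_abs]
    have h2 : (1 + |e|) * |x i| ≤ (1 + |e|) * 1 := by linarith [le_abs_self e]
    exact le_of_mul_le_mul_left h2 h0
  rw [EuclideanSpace.norm_eq]
  refine Real.sqrt_le_sqrt ?_
  calc ∑ i, ‖x i‖ ^ 2 ≤ ∑ _i : Fin d, (1 : ℝ) :=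
        Finset.sum_le_sum fun i _ => pow_le_one₀ (norm_nonneg _) (hx1 i)
    _ = d := by simp

theorem isBounded_scaledSelections [IsFiniteMeasure μ] (c : Fin d → ℝ) :
    Bornology.IsBounded (scaledSelections r X η c) := by
  refine (isBounded_iff_forall_norm_le).2
    ⟨(measureUnivNNReal μ : ℝ) ^ (2 : ℝ≥0∞).toReal⁻¹ * √d, ?_⟩
  rintro h ⟨ξ, h1, -, h3, -⟩
  refine Lp.norm_le_of_ae_bound (Real.sqrt_nonneg _) ?_
  filter_upwards [h1, ae_all_iff.2 h3] with ω h4 h5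
  exact norm_le_sqrt_of_eq_one_add_abs_mul h4 h5

theorem scaledSelections_nonempty [IsFiniteMeasure μ] {c : Fin d → ℝ} {ξ : Fin d → Lp ℝ p μ}
    (hη : MemLp η p μ) (hξ : IsLpSelection X ξ) (hξη : ∀ i, ∀ᵐ ω ∂μ, |ξ i ω| ≤ η ω)
    (hc : ∀ i, r i (ξ i) ≤ c i) : (scaledSelections r X η c).Nonempty := by
  set g : Ω → EuclideanSpace ℝ (Fin d) :=
    fun ω => WithLp.toLp 2 fun i => (1 + |η ω|)⁻¹ * ξ i ω with hg
  have hgξ : ∀ ω i, ξ i ω = (1 + |η ω|) * g ω i := fun ω i => by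
    have : (1 + |η ω|) ≠ 0 := by positivity
    simp only [hg]
    rw [mul_inv_cancel_left₀ this]
  have hgm : AEStronglyMeasurable g μ := by
    refine AEMeasurable.aestronglyMeasurable ?_
    have hm : AEMeasurable (fun ω i => (1 + |η ω|)⁻¹ * ξ i ω) μ :=
      aemeasurable_pi_iff.2 fun i =>
        ((hη.1.aemeasurable.abs.const_add 1).inv).mul (Lp.aestronglyMeasurable (ξ i)).aemeasurable
    exact (PiLp.continuous_toLp 2 (fun _ : Fin d => ℝ)).measurable.comp_aemeasurable hm
  have hg2 : MemLp g 2 μ := by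
    refine MemLp.of_bound hgm (√d) ?_
    filter_upwards [ae_all_iff.2 hξη] with ω h
    exact norm_le_sqrt_of_eq_one_add_abs_mul (hgξ ω) h
  refine ⟨hg2.toLp, ξ, ?_, hξ, hξη, hc⟩
  filter_upwards [hg2.coeFn_toLp] with ω h i
  rw [h, hgξ]

theorem convex_scaledSelections [IsFiniteMeasure μ] (hr : ∀ i, IsConvexRiskMeasure (r i))
    (hconv : ∀ᵐ ω ∂μ, Convex ℝ (X ω)) (c : Fin d → ℝ) :
    Convex ℝ (scaledSelections r X η c) := by
  rintro h ⟨ξ, h1, h2, h3, h4⟩ h' ⟨ξ', h1', h2', h3', h4'⟩ s t hs ht hst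
  have hcomb : ∀ᵐ ω ∂μ, ∀ i, (s • ξ i + t • ξ' i : Lp ℝ p μ) ω = s * ξ i ω + t * ξ' i ω := by
    filter_upwards [ae_all_iff.2 fun i => Lp.coeFn_add (s • ξ i) (t • ξ' i),
      ae_all_iff.2 fun i => Lp.coeFn_smul s (ξ i),
      ae_all_iff.2 fun i => Lp.coeFn_smul t (ξ' i)] with ω e1 e2 e3 i
    rw [e1 i, Pi.add_apply, e2 i, e3 i]
    rfl
  refine ⟨fun i => s • ξ i + t • ξ' i, ?_, ?_, fun i => ?_, fun i => ?_⟩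
  · filter_upwards [hcomb, h1, h1', Lp.coeFn_add (s • h) (t • h'), Lp.coeFn_smul s h,
      Lp.coeFn_smul t h'] with ω e e1 e1' e2 e3 e4 i
    rw [e i, e1 i, e1' i, e2, Pi.add_apply, e3, e4]
    simp only [Pi.smul_apply, PiLp.add_apply, PiLp.smul_apply, smul_eq_mul]
    ring
  · filter_upwards [hcomb, h2, h2', hconv] with ω e e2 e2' hc
    simp only [e]
    exact hc e2 e2' hs ht hst
  · filter_upwards [hcomb, h3 i, h3' i] with ω e e3 e3'
    rw [e i]
    calc |s * ξ i ω + t * ξ' i ω| ≤ |s * ξ i ω| + |t * ξ' i ω| := abs_add_le _ _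
      _ = s * |ξ i ω| + t * |ξ' i ω| := by rw [abs_mul, abs_mul, abs_of_nonneg hs, abs_of_nonneg ht]
      _ ≤ s * η ω + t * η ω := by gcongr
      _ = η ω := by rw [← add_mul, hst, one_mul]
  · obtain rfl : t = 1 - s := by linarith
    have h5 := (hr i).convex (ξ i) (ξ' i) s hs (by linarith)
    have h6 := mul_le_mul_of_nonneg_left (h4 i) hs
    have h7 := mul_le_mul_of_nonneg_left (h4' i) ht
    linarith

/-- An `L²`-convergent sequence of scaled selections has an almost surely convergent subsequence,
along which the dominated selections themselves converge. -/
theorem isClosed_scaledSelections [IsFiniteMeasure μ] (hp : 1 ≤ p)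
    (hr : ∀ i, IsConvexRiskMeasure (r i)) (hFatou : p = ∞ → ∀ i, HasFatouProperty (r i))
    (hclosed : ∀ ω, IsClosed (X ω)) (hη : MemLp η p μ) (c : Fin d → ℝ) :
    IsClosed (scaledSelections r X η c) := by
  have : Fact (1 ≤ p) := ⟨hp⟩
  refine IsSeqClosed.isClosed fun g h hg hlim => ?_
  choose ξ h1 h2 h3 h4 using hg
  obtain ⟨φ, -, hφ⟩ := (tendstoInMeasure_of_tendsto_Lp hlim).exists_seq_tendsto_ae
  have hconv : ∀ᵐ ω ∂μ, ∀ i,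
      Tendsto (fun n => ξ (φ n) i ω) atTop (𝓝 ((1 + |η ω|) * h ω i)) := by
    filter_upwards [hφ, ae_all_iff.2 h1] with ω e1 e2 i
    simp only [e2]
    exact (((EuclideanSpace.proj (𝕜 := ℝ) i).continuous.tendsto _).comp e1).const_mul _
  have hmem : ∀ i, MemLp (fun ω => (1 + |η ω|) * h ω i) p μ := by
    intro i
    refine hη.of_le ?_ ?_
    · refine aestronglyMeasurable_of_tendsto_ae atTop
        (fun n => Lp.aestronglyMeasurable (ξ (φ n) i)) ?_
      filter_upwards [hconv] with ω e using e i
    · filter_upwards [hconv, ae_all_iff.2 fun n => h3 n i] with ω e e3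
      exact (le_of_tendsto' (e i).abs fun n => e3 (φ n)).trans (le_abs_self _)
  set ζ : Fin d → Lp ℝ p μ := fun i => (hmem i).toLp
  have hζ : ∀ᵐ ω ∂μ, ∀ i, ζ i ω = (1 + |η ω|) * h ω i :=
    ae_all_iff.2 fun i => (hmem i).coeFn_toLp
  have hξζ : ∀ᵐ ω ∂μ, ∀ i, Tendsto (fun n => ξ (φ n) i ω) atTop (𝓝 (ζ i ω)) := by
    filter_upwards [hconv, hζ] with ω e1 e2 i
    rw [e2 i]
    exact e1 i
  refine ⟨ζ, hζ, ?_, fun i => ?_, fun i => ?_⟩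
  · filter_upwards [hξζ, ae_all_iff.2 h2] with ω e1 e2
    exact (hclosed ω).mem_of_tendsto (tendsto_pi_nhds.2 e1) (Eventually.of_forall fun n => e2 (φ n))
  · filter_upwards [hξζ, ae_all_iff.2 fun n => h3 n i] with ω e1 e2
    exact le_of_tendsto' (e1 i).abs fun n => e2 (φ n)
  · refine (hr i).le_of_dominated (fun h => hFatou h i) hη (fun n => h3 (φ n) i) ?_
      fun n => h4 (φ n) i
    filter_upwards [hξζ] with ω e using e i

end Selections

theorem mainTheorem2 {Ω : Type*} [MeasurableSpace Ω] (μ : Measure Ω) [IsProbabilityMeasure μ]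
    [μ.IsComplete] (p : ℝ≥0∞) (hp : 1 ≤ p) (d : ℕ)
    (r : Fin d → Lp ℝ p μ → ℝ) (hr : ∀ i, IsConvexRiskMeasure (r i))
    (hFatou : p = ∞ → ∀ i, HasFatouProperty (r i))
    (X : Ω → Set (Fin d → ℝ)) (hX : IsSetValuedPortfolio μ p X)
    (hconv : ∀ᵐ ω ∂μ, Convex ℝ (X ω))
    (hbdd : IsIntegrablyBounded μ p (fun ω => paretoBoundary (X ω))) :
    IsClosed (selectionRisk₀ r X) := by
  obtain ⟨η, hη, hXη⟩ := hbdd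
  refine isClosed_of_closure_subset fun a ha => ?_
  set c : ℕ → Fin d → ℝ := fun n i => a i + 1 / ((n : ℝ) + 1) with hc
  have hcanti : Antitone c := fun m n hmn i =>
    add_le_add_right (one_div_le_one_div_of_le (by positivity) (by gcongr)) _
  have hne : ∀ n, (scaledSelections r X η (c n)).Nonempty := by
    intro n
    obtain ⟨b, hb, hab⟩ := Metric.mem_closure_iff.1 ha (1 / ((n : ℝ) + 1)) (by positivity)
    obtain ⟨ξ, hξ, hξb⟩ := (mem_selectionRisk₀_iff hr).1 hb
    obtain ⟨ζ, hζ, hζη, hζξ⟩ :=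
      exists_dominated_selection hr hX.isClosed hX.isLowerSet hconv hη hXη hξ
    refine scaledSelections_nonempty hη hζ hζη fun i => ((hζξ i).trans (hξb i)).trans ?_
    have h1 := (dist_le_pi_dist a b i).trans hab.le
    rw [Real.dist_eq] at h1
    simp only [hc]
    linarith [(abs_le.1 h1).1]
  obtain ⟨h, hh⟩ := Convex.nonempty_iInter_of_antitone_of_isBounded
    (fun m n hmn => scaledSelections_mono (hcanti hmn))
    (fun n => convex_scaledSelections hr hconv (c n))
    (fun n => isClosed_scaledSelections hp hr hFatou hX.isClosed hη (c n)) hne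
    (isBounded_scaledSelections (c 0))
  rw [Set.mem_iInter] at hh
  choose ξ h1 h2 h3 h4 using hh
  -- the selection rescaled from `h` does not depend on the risk bound
  have hξ : ∀ n i, ξ n i = ξ 0 i := fun n i => Lp.ext <| by
    filter_upwards [h1 n, h1 0] with ω e1 e2
    rw [e1 i, e2 i]
  refine (mem_selectionRisk₀_iff hr).2 ⟨ξ 0, h2 0, fun i => ?_⟩
  have hlim : Tendsto (fun n : ℕ => a i + 1 / ((n : ℝ) + 1)) atTop (𝓝 (a i + 0)) :=
    tendsto_one_div_add_atTop_nhds_zero_nat.const_add _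
  rw [add_zero] at hlim
  exact ge_of_tendsto' hlim fun n => hξ n i ▸ h4 n i
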